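/- Let $G$ be a topological group, viewed as a uniform space with its right uniformity (generated by the sets $\{(x,y) : xy^{-1}\in U\}$, $U$ a neighbourhood of the neutral element $e$), and let $\mathrm{RUCB}(G)$ be the algebra of bounded right-uniformly continuous functions $G\to\mathbb{R}$. A mean on $G$ is a positive unital linear form on $\mathrm{RUCB}(G)$. For $g\in G$ let $\lambda_g(x)=gx$. Call $G$ *amenable* if there is a mean $\mu$ on $G$ with $\mu(f\circ\lambda_g)=\mu(f)$ for all $g\in G$, $f\in\mathrm{RUCB}(G)$, and *extremely amenable* if there is such an invariant mean which is moreover multiplicative, i.e. a $G$-fixed point in the Samuel compactification of $G$ (equivalently, if every continuous action of $G$ on a non-empty compact Hausdorff space has a fixed point). Subgroups carry the subspace topology. Let $\Delta(G)$ be the set of bounded, continuous, right-invariant pseudo-metrics on $G$. For a right-invariant pseudo-metric $d$, $g \in G$ and $H\le G$ put $d^g(x,y)=d(gx,gy)$ and $d_{G/H}(xH,yH)=\inf_{h\in H}d(x,yh)$. The *amenable length* $\ell(G,d)\in[0,\infty]$ of $G$ with respect to $d\in\Delta(G)$ is the infimum of $$\Bigl(\sum_{i=0}^{n-1}\bigl(\sup_{g\in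 G}\operatorname{diam}(G_{i+1}/G_i,\,d^g_{G/G_i})\bigr)^2\Bigr)^{1/2}$$ over all $n \in \mathbb{N}$ and all chains $\{e\}=G_0\le\dots\le G_n=G$ of amenable subgroups (with $\inf\emptyset=\infty$). The *approximate amenable length* of $G$ is $$\ell(G)=\sup_{U,E}\ \inf_{(H,d)}\ \ell(H,d)\in[0,\infty],$$ where $U$ ranges over the neighbourhoods of $e$, $E$ over the finite subsets of $G$, and $(H,d)$ over the pairs of an amenable subgroup $H\le G$ with $E\subseteq UH$ and a pseudo-metric $d\in\Delta(H)$ with $\{h\in H : d(e,h)<1\}\subseteq U$. Then the following hold. 1. If $\ell(G)=0$, then $G$ is extremely amenable. 2. Suppose that $G$ admits a bounded right-invariant metric $d$ generating its topology and a set $\mathscr{H}$ of amenable subgroups such that $(\mathscr{H},\subseteq)$ is directed, $G=\overline{\bigcup\mathscr{H}}$, and $\liminf_{H\in\mathscr{H}}\ell(H,d|_{H\times H})=0$. Then $\ell(G)=0$, and in particular $G$ is extremely amenable. 3. If some $d\in\Delta(G)$ generates the topology of $G$ and satisfies $\ell(G,d)=0$, then $\ell(G)=0$, and thus $G$ is extremely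 amenable. -/

import Mathlib

open scoped Topology ENNReal Pointwise

noncomputable section

/-! ### Means and the Samuel compactification of a uniform space -/

/-- `UCB(X)`: the unital real algebra of all bounded uniformly continuous real-valued functions on
a uniform space `X`. -/
def UCB (X : Type*) [UniformSpace X] : Subalgebra ℝ (X → ℝ) where
  carrier := {f | (∃ C : ℝ, ∀ x, |f x| ≤ C) ∧ UniformContinuous f}
  mul_mem' := by
    rintro f g ⟨⟨C, hC⟩, hf⟩ ⟨⟨D, hD⟩, hg⟩
    refine ⟨⟨C * D, fun x => ?_⟩, ?_⟩
    · rw [Pi.mul_apply, abs_mul]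
      exact mul_le_mul (hC x) (hD x) (abs_nonneg _) ((abs_nonneg _).trans (hC x))
    · have hb : Bornology.IsBounded (Set.Icc (-C) C ×ˢ Set.Icc (-D) D) :=
        (Metric.isBounded_Icc _ _).prod (Metric.isBounded_Icc _ _)
      have h := hb.uniformContinuousOn_smul (α := ℝ) (β := ℝ)
      rw [← uniformContinuousOn_univ]
      exact h.comp (uniformContinuousOn_univ.2 (hf.prodMk hg))
        fun x _ => ⟨abs_le.1 (hC x), abs_le.1 (hD x)⟩
  add_mem' := by
    rintro f g ⟨⟨C, hC⟩, hf⟩ ⟨⟨D, hD⟩, hg⟩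
    exact ⟨⟨C + D, fun x => (abs_add_le _ _).trans (add_le_add (hC x) (hD x))⟩, hf.add hg⟩
  algebraMap_mem' r := ⟨⟨|r|, fun _ => le_rfl⟩, uniformContinuous_const⟩

/-- A mean on a uniform space `X`: a positive unital linear form on `UCB(X)`. -/
structure IsMean {X : Type*} [UniformSpace X] (μ : UCB X →ₗ[ℝ] ℝ) : Prop where
  map_one : μ 1 = 1
  nonneg : ∀ f : UCB X, (∀ x, 0 ≤ f.1 x) → 0 ≤ μ f

/-- The points of the Samuel compactification of a uniform space `X`: the unital (necessarily
positive) `ℝ`-algebra homomorphisms `UCB(X) → ℝ`. -/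
abbrev Samuel (X : Type*) [UniformSpace X] : Type _ := UCB X →ₐ[ℝ] ℝ

/-! ### Amenability and extreme amenability -/

section Amenability

variable (G : Type*) [Group G] [TopologicalSpace G] [IsTopologicalGroup G]

/-- `RUCB(G)`: the algebra of bounded real-valued functions on `G` that are uniformly continuous
with respect to the right uniformity, whose entourages are generated by the sets
`{(x, y) | y * x⁻¹ ∈ U}`, `U` a neighbourhood of `1`. -/
abbrev RUCB : Subalgebra ℝ (G → ℝ) :=
  @UCB G (IsTopologicalGroup.rightUniformSpace G)

variable {G}

/-- The function `f ∘ λ_g : x ↦ f (g * x)`, for `f ∈ RUCB(G)` and `g ∈ G`. -/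
def RUCB.leftTranslate (g : G) (f : RUCB G) : RUCB G :=
  ⟨fun x => f.1 (g * x), by
    let : UniformSpace G := IsTopologicalGroup.rightUniformSpace G
    obtain ⟨⟨C, hC⟩, hf⟩ := f.2
    refine ⟨⟨C, fun x => hC _⟩, hf.comp ?_⟩
    have h : Filter.Tendsto (fun u : G => g * u * g⁻¹) (𝓝 1) (𝓝 1) := by
      have : Continuous (fun u : G => g * u * g⁻¹) := by fun_prop
      simpa using this.tendsto 1
    refine Filter.tendsto_comap_iff.2 ?_
    refine (h.comp Filter.tendsto_comap).congr fun p => ?_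
    simp [mul_assoc]⟩

variable (G)

/-- `G` is amenable: there is a mean on `G` (with its right uniformity) fixed by `G`, i.e. a
left-invariant mean on `RUCB(G)`. -/
def IsAmenable : Prop :=
  letI : UniformSpace G := IsTopologicalGroup.rightUniformSpace G
  ∃ μ : UCB G →ₗ[ℝ] ℝ, IsMean μ ∧
    ∀ (g : G) (f : RUCB G), μ (RUCB.leftTranslate g f) = μ f

/-- `G` is extremely amenable: the Samuel compactification of `G` (with its right uniformity)
contains a point fixed by `G`, i.e. there is a left-invariant multiplicative mean on `RUCB(G)`. -/
def IsExtremelyAmenable : Prop :=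
  letI : UniformSpace G := IsTopologicalGroup.rightUniformSpace G
  ∃ ξ : Samuel G, ∀ (g : G) (f : RUCB G), ξ (RUCB.leftTranslate g f) = ξ f

end Amenability

/-! ### Pseudo-metrics on groups -/

namespace PseudoMetric

/-- A set is open in the topology generated by the pseudo-metric `d`. -/
def IsOpenSet {X : Type*} (d : PseudoMetric X ℝ) (s : Set X) : Prop :=
  ∀ x ∈ s, ∃ r : ℝ, 0 < r ∧ {y | d x y < r} ⊆ s

/-- The topology generated by `d` is contained in the topology of `X`. -/
def IsContinuousOnSpace {X : Type*} [TopologicalSpace X] (d : PseudoMetric X ℝ) : Prop :=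
  ∀ s : Set X, d.IsOpenSet s → IsOpen s

/-- The topology generated by `d` coincides with the topology of `X`. -/
def IsCompatible {X : Type*} [TopologicalSpace X] (d : PseudoMetric X ℝ) : Prop :=
  ∀ s : Set X, d.IsOpenSet s ↔ IsOpen s

/-- `d` is a metric: points at distance `0` are equal. -/
def IsMetric {X : Type*} (d : PseudoMetric X ℝ) : Prop :=
  ∀ x y : X, d x y = 0 → x = y

/-- `d` is bounded. -/
def IsBdd {X : Type*} (d : PseudoMetric X ℝ) : Prop :=
  ∃ C : ℝ, ∀ x y : X, d x y ≤ C

/-- `d` is right-invariant: `d (x * g) (y * g) = d x y`. -/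
def IsRightInvariant {G : Type*} [Group G] (d : PseudoMetric G ℝ) : Prop :=
  ∀ g x y : G, d (x * g) (y * g) = d x y

/-- `d ∈ Δ(G)`: a bounded, continuous, right-invariant pseudo-metric on `G`. -/
structure MemDelta {G : Type*} [Group G] [TopologicalSpace G] (d : PseudoMetric G ℝ) : Prop where
  isBdd : d.IsBdd
  isContinuous : d.IsContinuousOnSpace
  isRightInvariant : d.IsRightInvariant

/-- The restriction of `d` to a subgroup. -/
def restrict {G : Type*} [Group G] (d : PseudoMetric G ℝ) (H : Subgroup G) :
    PseudoMetric H ℝ where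
  toFun x y := d x y
  refl' _ := d.refl _
  symm' _ _ := d.symm _ _
  triangle' _ _ _ := d.triangle _ _ _

/-- The pseudo-metric `d^g`, `d^g (x, y) = d (g * x, g * y)`. -/
def translate {G : Type*} [Group G] (d : PseudoMetric G ℝ) (g : G) : PseudoMetric G ℝ where
  toFun x y := d (g * x) (g * y)
  refl' _ := d.refl _
  symm' _ _ := d.symm _ _
  triangle' _ _ _ := d.triangle _ _ _

/-- The distance `d_{G/H}(xH, yH) = inf_{h ∈ H} d(x, y h)` of two cosets, in terms of
representatives (it does not depend on their choice if `d` is right-invariant). -/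
def cosetDist {G : Type*} [Group G] (d : PseudoMetric G ℝ) (H : Subgroup G) (x y : G) : ℝ≥0∞ :=
  ⨅ h : H, ENNReal.ofReal (d x (y * h))

/-- The diameter of `K / H = {xH | x ∈ K}` with respect to `d_{G/H}`. -/
def cosetDiam {G : Type*} [Group G] (d : PseudoMetric G ℝ) (K H : Subgroup G) : ℝ≥0∞ :=
  ⨆ x : K, ⨆ y : K, d.cosetDist H x y

end PseudoMetric

/-! ### Amenable length -/

section AmenableLength

variable {G : Type*} [Group G] [TopologicalSpace G] [IsTopologicalGroup G]

/-- `(C 0, …, C n) ∈ 𝒜*(G)`: a chain `{e} = C 0 ≤ … ≤ C n = G` of amenable topological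
subgroups of `G`. -/
structure IsAmenableChain {n : ℕ} (C : Fin (n + 1) → Subgroup G) : Prop where
  amenable : ∀ i, IsAmenable (C i)
  mono : Monotone C
  first : C 0 = ⊥
  last : C (Fin.last n) = ⊤

/-- `ℓ(C 0, …, C n; d) = (∑_{i < n} (sup_{g ∈ G} diam (C (i+1) / C i, d^g_{G / C i}))²)^{1/2}`. -/
def chainLength {n : ℕ} (C : Fin (n + 1) → Subgroup G) (d : PseudoMetric G ℝ) : ℝ≥0∞ :=
  (∑ i : Fin n, (⨆ g : G, (d.translate g).cosetDiam (C i.succ) (C i.castSucc)) ^ 2) ^ (1 / 2 : ℝ)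

variable (G)

/-- The amenable length `ℓ(G, d) ∈ [0, ∞]`: the infimum of `ℓ(C 0, …, C n; d)` over all
`(C 0, …, C n) ∈ 𝒜*(G)`, with `inf ∅ = ∞`. -/
def amenableLength (d : PseudoMetric G ℝ) : ℝ≥0∞ :=
  ⨅ (n : ℕ) (C : Fin (n + 1) → Subgroup G) (_ : IsAmenableChain C), chainLength C d

variable {G}

/-- `(H, d) ∈ 𝒯_G(U, E)`: `H` is an amenable topological subgroup of `G` with `E ⊆ U H`, and
`d ∈ Δ(H)` has its open unit ball at `e` contained in `U`. -/
structure MemT (U : Set G) (E : Finset G) (H : Subgroup G) (d : PseudoMetric H ℝ) : Prop where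
  amenable : IsAmenable H
  memDelta : d.MemDelta
  subset_mul : (E : Set G) ⊆ U * (H : Set G)
  ball_subset : ∀ h : H, d 1 h < 1 → (h : G) ∈ U

variable (G)

/-- The approximate amenable length
`ℓ(G) = sup_{U, E} inf_{(H, d) ∈ 𝒯_G(U, E)} ℓ(H, d) ∈ [0, ∞]`, where `U` ranges over the
neighbourhoods of the neutral element and `E` over the finite subsets of `G`. -/
def approximateAmenableLength : ℝ≥0∞ :=
  ⨆ (U : Set G) (_ : U ∈ 𝓝 (1 : G)) (E : Finset G),
    ⨅ (H : Subgroup G) (d : PseudoMetric H ℝ) (_ : MemT U E H d), amenableLength H d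

end AmenableLength

end

/-!
The theorem rests on an `L²` concentration estimate for invariant means, a finitely additive
version of the martingale method.

An invariant mean `m` on an amenable subgroup `K` of a topological group `G` induces an averaging
operator `f ↦ (x ↦ m (h ↦ f (x * h)))` on `RUCB(G)`. It is positive and unital, commutes with left
translations, takes values in the functions on `G / K`, and does not increase Lipschitz constants
with respect to right-invariant pseudo-metrics. Composing these operators along a chain
`{e} = C 0 ≤ … ≤ C n = G` gives a left-invariant mean on `G`. When the average over `C (i + 1)` is
taken, a `1`-Lipschitz function which factors through `G / C i` oscillates on every coset of
`C (i + 1)` by at most the diameter of `C (i + 1) / C i`, so the step adds at most the square of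
that diameter to the variance (`IsConcentratedAverage.step`). Hence every `L`-Lipschitz function
has variance at most `L² ℓ²`, where `ℓ` is the length of the chain (`IsAmenableChain.exists_mean`,
`exists_mean_of_amenableLength_lt`).

Let `(H, d)` be a pair as in the definition of the approximate amenable length, for `U` and `E`. If
`f` in `RUCB(G)` varies by at most `δ` under left translation by elements of `U`, then `f` on `H`
is `δ`-close to a `d`-Lipschitz function, whose Lipschitz constant depends only on the bound of
`f`. So a concentrated invariant mean on `H`, regarded as a mean on `G`, gives `f` a small variance,
and since `E ⊆ U H` it is almost invariant under `E` (`MemT.exists_mean`). If the approximate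
amenable length vanishes, a limit of such means along an ultrafilter is invariant and has
variance zero, and by polarisation a mean with vanishing variance is multiplicative
(`isExtremelyAmenable_of_approximateAmenableLength_eq_zero`).

For a compatible pseudo-metric `d` some multiple `c * d` has its unit ball inside a given
neighbourhood of the identity, and `ℓ(H, c * d) = c * ℓ(H, d)`. It thus suffices to find, for all
`U` and `E`, amenable subgroups `H` with `E ⊆ U H` for which `ℓ(H, d)` is arbitrarily small
(`approximateAmenableLength_eq_zero_of_isCompatible`). In a directed family with dense union all
sufficiently large members satisfy `E ⊆ U H`; if `ℓ(G, d) = 0`, then `H = G` will do.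
-/

/-! ### Bounded right-uniformly continuous functions -/

section RUCBBasics

variable {G : Type*} [Group G] [TopologicalSpace G] [IsTopologicalGroup G]

/-- Right-uniform continuity of `f` says that left translation by a small `u` moves `f` uniformly
little. -/
theorem mem_RUCB_iff {f : G → ℝ} :
    f ∈ RUCB G ↔ (∃ C : ℝ, ∀ x, |f x| ≤ C) ∧
      ∀ ε > 0, ∃ U ∈ 𝓝 (1 : G), ∀ u ∈ U, ∀ x, |f (u * x) - f x| ≤ ε := by
  let : UniformSpace G := IsTopologicalGroup.rightUniformSpace G
  have key : UniformContinuous f ↔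
      ∀ ε > 0, ∃ U ∈ 𝓝 (1 : G), ∀ u ∈ U, ∀ x, |f (u * x) - f x| ≤ ε := by
    have hu : uniformity G = Filter.comap (fun p : G × G => p.2 * p.1⁻¹) (𝓝 1) := rfl
    have hb : (uniformity G).HasBasis (fun U : Set G => U ∈ 𝓝 (1 : G))
        (fun U => (fun p : G × G => p.2 * p.1⁻¹) ⁻¹' U) := by
      rw [hu]
      exact (Filter.basis_sets _).comap _
    rw [hb.uniformContinuous_iff Metric.uniformity_basis_dist_le]
    refine forall₂_congr fun ε _ => exists_congr fun U => and_congr_right fun _ => ?_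
    constructor
    · intro h u hu x
      have := h x (u * x) (by simpa using hu)
      rwa [Set.mem_ofPred_eq, dist_comm, Real.dist_eq] at this
    · intro h x y hxy
      have := h _ hxy x
      rw [Set.mem_ofPred_eq, dist_comm, Real.dist_eq]
      simpa using this
  exact and_congr_right fun _ => key

/-- A mean on `RUCB(G)`, i.e. on `G` with its right uniformity. -/
abbrev IsRUCBMean (μ : RUCB G →ₗ[ℝ] ℝ) : Prop :=
  @IsMean G (IsTopologicalGroup.rightUniformSpace G) μ

theorem PseudoMetric.ball_mem_nhds {X : Type*} [TopologicalSpace X] {d : PseudoMetric X ℝ}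
    (hd : d.IsContinuousOnSpace) (x : X) {r : ℝ} (hr : 0 < r) : {y | d x y < r} ∈ 𝓝 x := by
  refine (hd _ fun y hy => ?_).mem_nhds (by simpa using hr)
  refine ⟨r - d x y, sub_pos.2 hy, fun z hz => ?_⟩
  have := d.triangle x y z
  simp only [Set.mem_ofPred_eq] at hz ⊢
  linarith

/-- A bounded function that is Lipschitz for a continuous right-invariant pseudo-metric is
right-uniformly continuous. -/
theorem PseudoMetric.MemDelta.mem_RUCB {d : PseudoMetric G ℝ} (hd : d.MemDelta) {f : G → ℝ}
    {C L : ℝ} (hL : 0 ≤ L) (hC : ∀ x, |f x| ≤ C) (hf : ∀ x y, f x - f y ≤ L * d x y) :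
    f ∈ RUCB G := by
  refine mem_RUCB_iff.2 ⟨⟨C, hC⟩, fun ε hε => ?_⟩
  refine ⟨_, PseudoMetric.ball_mem_nhds hd.isContinuous 1 (div_pos hε (by linarith : 0 < L + 1)),
    fun u hu x => ?_⟩
  have h1 : d x (u * x) = d 1 u := by simpa using hd.isRightInvariant x 1 u
  have h2 : L * d 1 u ≤ ε := by
    have hu' : d 1 u < ε / (L + 1) := hu
    rw [lt_div_iff₀ (by linarith)] at hu'
    have := d.triangle 1 u 1
    rw [d.symm u 1, d.refl] at this
    nlinarith
  have h3 := hf x (u * x)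
  have h4 := hf (u * x) x
  rw [d.symm (u * x) x] at h4
  rw [h1] at h3 h4
  exact abs_le.2 ⟨by linarith, by linarith⟩

/-- Restriction of functions in `RUCB(G)` to a subgroup. -/
def RUCB.restrict (H : Subgroup G) : RUCB G →ₐ[ℝ] RUCB H where
  toFun f := ⟨fun h => f.1 h, by
    obtain ⟨⟨C, hC⟩, hf⟩ := mem_RUCB_iff.1 f.2
    refine mem_RUCB_iff.2 ⟨⟨C, fun h => hC h⟩, fun ε hε => ?_⟩
    obtain ⟨U, hU, hUf⟩ := hf ε hε
    refine ⟨(↑) ⁻¹' U, continuous_subtype_val.continuousAt.preimage_mem_nhds (by simpa using hU),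
      fun u hu x => by simpa using hUf u hu x⟩⟩
  map_one' := rfl
  map_mul' _ _ := rfl
  map_zero' := rfl
  map_add' _ _ := rfl
  commutes' _ := rfl

end RUCBBasics

/-! ### Elementary properties of means -/

namespace IsMean

variable {X : Type*} {_ : UniformSpace X} {μ : UCB X →ₗ[ℝ] ℝ}

theorem mono (hμ : IsMean μ) {f g : UCB X} (h : ∀ x, f.1 x ≤ g.1 x) : μ f ≤ μ g := by
  have := hμ.nonneg (g - f) fun x => sub_nonneg.2 (h x)
  rwa [map_sub, sub_nonneg] at this

theorem map_smul_one (hμ : IsMean μ) (c : ℝ) : μ (c • (1 : UCB X)) = c := by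
  rw [map_smul, hμ.map_one, smul_eq_mul, mul_one]

theorem le_const (hμ : IsMean μ) {f : UCB X} {c : ℝ} (h : ∀ x, f.1 x ≤ c) : μ f ≤ c := by
  rw [← hμ.map_smul_one c]
  exact hμ.mono fun x => by simpa using h x

theorem const_le (hμ : IsMean μ) {f : UCB X} {c : ℝ} (h : ∀ x, c ≤ f.1 x) : c ≤ μ f := by
  rw [← hμ.map_smul_one c]
  exact hμ.mono fun x => by simpa using h x

theorem abs_le_const (hμ : IsMean μ) {f : UCB X} {c : ℝ} (h : ∀ x, |f.1 x| ≤ c) : |μ f| ≤ c :=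
  abs_le.2 ⟨hμ.const_le fun x => (abs_le.1 (h x)).1, hμ.le_const fun x => (abs_le.1 (h x)).2⟩

theorem abs_sub_le (hμ : IsMean μ) {f g : UCB X} {c : ℝ} (h : ∀ x, |f.1 x - g.1 x| ≤ c) :
    |μ f - μ g| ≤ c := by
  rw [← map_sub]
  exact hμ.abs_le_const h

/-- The second moment of `f` around `c`. -/
theorem map_sub_const_sq (hμ : IsMean μ) (f : UCB X) (c : ℝ) :
    μ ((f - c • 1) * (f - c • 1)) = μ (f * f) - 2 * c * μ f + c ^ 2 := by
  have : (f - c • 1) * (f - c • 1) = f * f - (2 * c) • f + (c ^ 2) • (1 : UCB X) := by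
    ext x
    simp
    ring
  rw [this, map_add, map_sub, hμ.map_smul_one, map_smul, smul_eq_mul]

/-- Cauchy–Schwarz against the constant function `1`. -/
theorem sq_map_le (hμ : IsMean μ) (f : UCB X) : μ f ^ 2 ≤ μ (f * f) := by
  have h := hμ.nonneg ((f - (μ f) • 1) * (f - (μ f) • 1)) fun x => mul_self_nonneg _
  rw [hμ.map_sub_const_sq] at h
  nlinarith

/-- The variance of a function is at most the square of its oscillation. -/
theorem variance_le_sq_osc (hμ : IsMean μ) {f : UCB X} {D : ℝ}
    (h : ∀ x y, f.1 x - f.1 y ≤ D) : μ (f * f) ≤ μ f ^ 2 + D ^ 2 := by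
  have h1 : ∀ x, f.1 x - D ≤ μ f := fun x => hμ.const_le fun y => by linarith [h x y]
  have h2 : ∀ x, μ f ≤ f.1 x + D := fun x => hμ.le_const fun y => by linarith [h y x]
  have h3 : μ ((f - (μ f) • 1) * (f - (μ f) • 1)) ≤ D ^ 2 := by
    refine hμ.le_const fun x => ?_
    have : ((f - (μ f) • 1) * (f - (μ f) • 1) : UCB X).1 x = (f.1 x - μ f) ^ 2 := by
      simp [sq]
    rw [this]
    exact sq_le_sq' (by linarith [h2 x]) (by linarith [h1 x])
  rw [hμ.map_sub_const_sq] at h3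
  nlinarith

/-- The variance depends continuously on the function in the uniform norm. -/
theorem variance_le_of_abs_sub_le (hμ : IsMean μ) {f g : UCB X} {v δ : ℝ}
    (hg : μ (g * g) ≤ μ g ^ 2 + v) (hfg : ∀ x, |f.1 x - g.1 x| ≤ δ) :
    μ (f * f) ≤ μ f ^ 2 + 2 * v + 2 * δ ^ 2 := by
  -- `(f - μ g)² ≤ 2 (g - μ g)² + 2 (f - g)²`, and `μ f` minimises the second moment of `f`.
  have h1 : μ ((f - (μ g) • 1) * (f - (μ g) • 1)) ≤
      μ ((2 : ℝ) • ((g - (μ g) • 1) * (g - (μ g) • 1)) + (2 * δ ^ 2) • 1) := by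
    refine hμ.mono fun x => ?_
    have hx : (f.1 x - g.1 x) ^ 2 ≤ δ ^ 2 := sq_le_sq' (abs_le.1 (hfg x)).1 (abs_le.1 (hfg x)).2
    have e1 : ((f - (μ g) • 1) * (f - (μ g) • 1) : UCB X).1 x = (f.1 x - μ g) ^ 2 := by
      simp [sq]
    have e2 : ((2 : ℝ) • ((g - (μ g) • 1) * (g - (μ g) • 1)) + (2 * δ ^ 2) • 1 : UCB X).1 x
        = 2 * (g.1 x - μ g) ^ 2 + 2 * δ ^ 2 := by
      simp [sq]
    rw [e1, e2]
    nlinarith [sq_nonneg ((f.1 x - g.1 x) - (g.1 x - μ g))]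
  rw [map_add, map_smul, hμ.map_smul_one, hμ.map_sub_const_sq, hμ.map_sub_const_sq,
    smul_eq_mul] at h1
  nlinarith [sq_nonneg (μ f - μ g)]

end IsMean

/-! ### Averaging over amenable subgroups -/

/-- The oscillation along a coset `x K'` of a Lipschitz function on `G / K` is controlled by the
diameter of `K' / K`. -/
theorem sub_le_of_cosetDist_le {G : Type*} [Group G] {d : PseudoMetric G ℝ}
    {K : Subgroup G} {f : G → ℝ} {L a : ℝ}
    (hL : 0 ≤ L) (ha : 0 ≤ a) (hK : ∀ x, ∀ k ∈ K, f (x * k) = f x)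
    (hf : ∀ x y, f x - f y ≤ L * d x y) {x y : G} (h : d.cosetDist K x y ≤ ENNReal.ofReal a) :
    f x - f y ≤ L * a := by
  refine le_of_forall_pos_le_add fun ε hε => ?_
  have hlt : d.cosetDist K x y < ENNReal.ofReal (a + ε / (L + 1)) :=
    h.trans_lt ((ENNReal.ofReal_lt_ofReal_iff (by positivity)).2 (by
      have : 0 < ε / (L + 1) := by positivity
      linarith))
  obtain ⟨k, hk⟩ := iInf_lt_iff.1 hlt
  have hk' := (ENNReal.ofReal_lt_ofReal_iff (by positivity)).1 hk
  have h1 := hf x (y * k)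
  rw [hK y k k.2] at h1
  have h2 : L * (ε / (L + 1)) ≤ ε := by
    rw [← mul_div_assoc, div_le_iff₀ (by positivity)]
    nlinarith
  nlinarith [mul_le_mul_of_nonneg_left hk'.le hL]

section Averaging

variable {G : Type*} [Group G] [TopologicalSpace G] [IsTopologicalGroup G]

/-- The function `h ↦ f (x * h)` on a subgroup `K`. -/
def RUCB.orbitMap (K : Subgroup G) (x : G) : RUCB G →ₐ[ℝ] RUCB K where
  toFun f := RUCB.restrict K (RUCB.leftTranslate x f)
  map_one' := rfl
  map_mul' _ _ := rfl
  map_zero' := rfl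
  map_add' _ _ := rfl
  commutes' _ := rfl

/-- The averaging operator of a mean `m` on a subgroup `K`: it maps `f` to
`x ↦ m (h ↦ f (x * h))`. -/
def RUCB.average {K : Subgroup G} (m : RUCB K →ₗ[ℝ] ℝ) (hm : IsRUCBMean m) :
    RUCB G →ₗ[ℝ] RUCB G where
  toFun f := ⟨fun x => m (RUCB.orbitMap K x f), by
    obtain ⟨⟨C, hC⟩, hf⟩ := mem_RUCB_iff.1 f.2
    refine mem_RUCB_iff.2 ⟨⟨C, fun x => IsMean.abs_le_const hm fun h => hC _⟩, fun ε hε => ?_⟩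
    obtain ⟨U, hU, hUf⟩ := hf ε hε
    refine ⟨U, hU, fun u hu x => IsMean.abs_sub_le hm fun h => ?_⟩
    have := hUf u hu (x * h)
    rwa [← mul_assoc] at this⟩
  map_add' f g := by
    ext x
    exact (congrArg m (map_add (RUCB.orbitMap K x) f g)).trans (map_add m _ _)
  map_smul' c f := by
    ext x
    exact (congrArg m (map_smul (RUCB.orbitMap K x) c f)).trans (map_smul m _ _)

theorem RUCB.average_apply {K : Subgroup G} (m : RUCB K →ₗ[ℝ] ℝ) (hm : IsRUCBMean m)
    (f : RUCB G) (x : G) : (RUCB.average m hm f).1 x = m (RUCB.orbitMap K x f) := rfl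

/-- `T` behaves like a conditional expectation onto the functions on `G / K` which is compatible
with left translations, does not increase Lipschitz constants with respect to `d`, and satisfies
the conditional variance bound `T (f²) ≤ (T f)² + L² v` for `L`-Lipschitz functions `f`. -/
structure IsConcentratedAverage (d : PseudoMetric G ℝ) (K : Subgroup G) (v : ℝ)
    (T : RUCB G →ₗ[ℝ] RUCB G) : Prop where
  map_one : T 1 = 1
  mono : ∀ f g : RUCB G, (∀ x, f.1 x ≤ g.1 x) → ∀ x, (T f).1 x ≤ (T g).1 x
  map_leftTranslate : ∀ g f, T (RUCB.leftTranslate g f) = RUCB.leftTranslate g (T f)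
  map_mul_right : ∀ f x, ∀ k ∈ K, (T f).1 (x * k) = (T f).1 x
  lipschitz : ∀ (f : RUCB G) (L : ℝ), 0 ≤ L → (∀ x y, f.1 x - f.1 y ≤ L * d x y) →
    ∀ x y, (T f).1 x - (T f).1 y ≤ L * d x y
  variance : ∀ (f : RUCB G) (L : ℝ), 0 ≤ L → (∀ x y, f.1 x - f.1 y ≤ L * d x y) →
    ∀ x, (T (f * f)).1 x ≤ (T f).1 x ^ 2 + L ^ 2 * v

theorem IsConcentratedAverage.id (d : PseudoMetric G ℝ) :
    IsConcentratedAverage d ⊥ 0 LinearMap.id where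
  map_one := rfl
  mono _ _ h := h
  map_leftTranslate _ _ := rfl
  map_mul_right f x k hk := by
    rw [Subgroup.mem_bot.1 hk, mul_one]
  lipschitz _ _ _ h := h
  variance f L _ _ x := by
    have : (f * f : RUCB G).1 x = f.1 x ^ 2 := (sq _).symm
    simp [this]

/-- Averaging over the next subgroup of a chain adds the squared diameter of the quotient to the
variance bound. -/
theorem IsConcentratedAverage.step {d : PseudoMetric G ℝ} (hd : d.IsRightInvariant)
    {K K' : Subgroup G} (hK' : IsAmenable K') {v a : ℝ} (ha : 0 ≤ a)
    (hdiam : ∀ g, ∀ x ∈ K', ∀ y ∈ K', d.cosetDist K (g * x) (g * y) ≤ ENNReal.ofReal a)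
    {T : RUCB G →ₗ[ℝ] RUCB G} (hT : IsConcentratedAverage d K v T) :
    ∃ S, IsConcentratedAverage d K' (v + a ^ 2) S := by
  obtain ⟨m, hm, hinv⟩ := hK'
  have hm' : IsRUCBMean m := hm
  refine ⟨(RUCB.average m hm').comp T, ?_, ?_, ?_, ?_, ?_, ?_⟩
  · ext x
    simp only [LinearMap.comp_apply, hT.map_one]
    exact @IsMean.map_one _ (_) _ hm'
  · intro f g hfg x
    exact IsMean.mono hm' fun h => hT.mono f g hfg _
  · intro g f
    ext x
    simp only [LinearMap.comp_apply, hT.map_leftTranslate]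
    rw [RUCB.average_apply]
    refine congrArg m ?_
    ext h
    exact congrArg (T f).1 (mul_assoc _ _ _).symm
  · intro f x k hk
    have := hinv ⟨k, hk⟩ (RUCB.orbitMap K' x (T f))
    refine Eq.trans (congrArg m ?_) this
    ext h
    exact congrArg (T f).1 (mul_assoc _ _ _)
  · intro f L hL hf x y
    have h1 : ∀ h, (RUCB.orbitMap K' x (T f)).1 h ≤
        (RUCB.orbitMap K' y (T f) + (L * d x y) • 1 : RUCB K').1 h := fun h => by
      have h2 := hT.lipschitz f L hL hf (x * h) (y * h)
      rw [hd] at h2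
      have h3 : (RUCB.orbitMap K' y (T f) + (L * d x y) • 1 : RUCB K').1 h
        = (T f).1 (y * h) + L * d x y := by
        change _ + (L * d x y) * 1 = _
        rw [mul_one]; rfl
      rw [h3]
      change (T f).1 (x * h) ≤ _
      linarith
    have h4 := IsMean.mono hm' h1
    rw [map_add, IsMean.map_smul_one hm'] at h4
    simp only [LinearMap.comp_apply]
    rw [RUCB.average_apply, RUCB.average_apply]
    linarith
  · intro f L hL hf x
    simp only [LinearMap.comp_apply]
    rw [RUCB.average_apply, RUCB.average_apply]
    have h1 : m (RUCB.orbitMap K' x (T (f * f))) ≤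
        m (RUCB.orbitMap K' x (T f) * RUCB.orbitMap K' x (T f) + (L ^ 2 * v) • 1) :=
      IsMean.mono hm' fun h => by
        have h2 := hT.variance f L hL hf (x * h)
        have h3 : (RUCB.orbitMap K' x (T f) * RUCB.orbitMap K' x (T f) + (L ^ 2 * v) • 1
          : RUCB K').1 h = (T f).1 (x * h) ^ 2 + L ^ 2 * v := by
          change (T f).1 (x * h) * (T f).1 (x * h) + (L ^ 2 * v) * 1 = _
          ring
        rw [h3]
        exact h2
    have h5 : m (RUCB.orbitMap K' x (T f) * RUCB.orbitMap K' x (T f)) ≤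
        m (RUCB.orbitMap K' x (T f)) ^ 2 + (L * a) ^ 2 :=
      IsMean.variance_le_sq_osc hm' fun h h' =>
        sub_le_of_cosetDist_le hL ha (hT.map_mul_right f) (hT.lipschitz f L hL hf)
          (hdiam x h h.2 h' h'.2)
    rw [map_add, IsMean.map_smul_one hm'] at h1
    nlinarith

/-- Along a chain of amenable subgroups whose successive quotients have diameter at most `a i`,
there is an invariant mean for which every `L`-Lipschitz function has variance at most
`L² ∑ (a i)²`. -/
theorem IsAmenableChain.exists_mean {d : PseudoMetric G ℝ} (hd : d.IsRightInvariant) {n : ℕ}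
    {C : Fin (n + 1) → Subgroup G} (hC : IsAmenableChain C) {a : Fin n → ℝ} (ha : ∀ i, 0 ≤ a i)
    (hdiam : ∀ i g, (d.translate g).cosetDiam (C i.succ) (C i.castSucc) ≤ ENNReal.ofReal (a i)) :
    ∃ μ : RUCB G →ₗ[ℝ] ℝ, IsRUCBMean μ ∧ (∀ g f, μ (RUCB.leftTranslate g f) = μ f) ∧
      ∀ (f : RUCB G) (L : ℝ), 0 ≤ L → (∀ x y, f.1 x - f.1 y ≤ L * d x y) →
        μ (f * f) ≤ μ f ^ 2 + L ^ 2 * ∑ i, a i ^ 2 := by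
  have key : ∀ i : Fin (n + 1), ∃ T, IsConcentratedAverage d (C i)
      (∑ j : Fin n with j.castSucc < i, a j ^ 2) T := by
    intro i
    induction i using Fin.induction with
    | zero =>
      refine ⟨LinearMap.id, ?_⟩
      rw [hC.first]
      simpa using IsConcentratedAverage.id d
    | succ i ih =>
      obtain ⟨T, hT⟩ := ih
      have hs : (Finset.univ.filter fun j : Fin n => j.castSucc < i.succ) =
          insert i (Finset.univ.filter fun j : Fin n => j.castSucc < i.castSucc) := by
        ext j
        simp only [Finset.mem_filter, Finset.mem_univ, true_and, Finset.mem_insert, Fin.lt_def,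
          Fin.ext_iff, Fin.val_castSucc, Fin.val_succ]
        omega
      rw [hs, Finset.sum_insert (by simp), add_comm]
      refine hT.step hd (hC.amenable _) (ha i) fun g x hx y hy => ?_
      refine le_trans ?_ (hdiam i g)
      refine le_trans (le_of_eq ?_) (le_iSup₂ (f := fun x y : C i.succ =>
        (d.translate g).cosetDist (C i.castSucc) x y) ⟨x, hx⟩ ⟨y, hy⟩)
      exact iInf_congr fun h => by rw [mul_assoc]; rfl
  obtain ⟨T, hT⟩ := key (Fin.last n)
  have hs : (Finset.univ.filter fun j : Fin n => j.castSucc < Fin.last n) = Finset.univ := by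
    simp [Fin.castSucc_lt_last]
  rw [hs, hC.last] at hT
  let μ : RUCB G →ₗ[ℝ] ℝ :=
    { toFun := fun f => (T f).1 1
      map_add' := fun f g => by rw [map_add]; rfl
      map_smul' := fun c f => by rw [map_smul]; rfl }
  have hμ : IsRUCBMean μ := by
    refine @IsMean.mk G (_) μ ?_ fun f hf => ?_
    · exact congrFun (congrArg Subtype.val hT.map_one) 1
    · have := hT.mono 0 f hf 1
      rwa [map_zero] at this
  refine ⟨μ, hμ, fun g f => ?_, fun f L hL hf => hT.variance f L hL hf 1⟩
  change (T (RUCB.leftTranslate g f)).1 1 = (T f).1 1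
  rw [hT.map_leftTranslate, ← hT.map_mul_right f 1 g trivial]
  change (T f).1 (g * 1) = _
  rw [mul_one, one_mul]

end Averaging

/-! ### From amenable length to concentration of invariant means -/

section Concentration

/-- An amenable length below `ε` provides an invariant mean for which every `L`-Lipschitz function
has variance at most `L² ε²`, uniformly in the function. -/
theorem exists_mean_of_amenableLength_lt {G : Type*} [Group G] [TopologicalSpace G]
    [IsTopologicalGroup G] {d : PseudoMetric G ℝ} (hd : d.IsRightInvariant) {ε : ℝ} (hε : 0 ≤ ε)
    (h : amenableLength G d < ENNReal.ofReal ε) :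
    ∃ μ : RUCB G →ₗ[ℝ] ℝ, IsRUCBMean μ ∧ (∀ g f, μ (RUCB.leftTranslate g f) = μ f) ∧
      ∀ (f : RUCB G) (L : ℝ), 0 ≤ L → (∀ x y, f.1 x - f.1 y ≤ L * d x y) →
        μ (f * f) ≤ μ f ^ 2 + L ^ 2 * ε ^ 2 := by
  obtain ⟨n, h⟩ := iInf_lt_iff.1 h
  obtain ⟨C, h⟩ := iInf_lt_iff.1 h
  obtain ⟨hC, h⟩ := iInf_lt_iff.1 h
  set D : Fin n → ℝ≥0∞ := fun i =>
    ⨆ g : G, (d.translate g).cosetDiam (C i.succ) (C i.castSucc) with hD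
  have hsum : ∑ i, D i ^ 2 ≤ ENNReal.ofReal (ε ^ 2) := by
    have h1 : (∑ i, D i ^ 2) ^ (1 / 2 : ℝ) ≤ ENNReal.ofReal ε := h.le
    have h2 := ENNReal.rpow_le_rpow h1 (by norm_num : (0 : ℝ) ≤ 2)
    rw [← ENNReal.rpow_mul] at h2
    norm_num at h2
    rwa [ENNReal.ofReal_pow hε]
  have hfin : ∀ i, D i ≠ ∞ := fun i hi => by
    have h1 : D i ^ 2 ≤ ∑ i, D i ^ 2 :=
      Finset.single_le_sum (f := fun i => D i ^ 2) (fun _ _ => zero_le) (Finset.mem_univ i)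
    have h2 := (h1.trans hsum).trans_lt ENNReal.ofReal_lt_top
    simp [hi] at h2
  obtain ⟨μ, hμ, hinv, hvar⟩ := hC.exists_mean hd (a := fun i => (D i).toReal)
    (fun _ => ENNReal.toReal_nonneg) fun i g => by
      rw [ENNReal.ofReal_toReal (hfin i)]
      exact le_iSup (fun g : G => (d.translate g).cosetDiam (C i.succ) (C i.castSucc)) g
  refine ⟨μ, hμ, hinv, fun f L hL hf => (hvar f L hL hf).trans ?_⟩
  gcongr
  have h3 : ∑ i, (D i).toReal ^ 2 = (∑ i, D i ^ 2).toReal := by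
    rw [ENNReal.toReal_sum fun i _ => ENNReal.pow_ne_top (hfin i)]
    simp
  rw [h3]
  exact ENNReal.toReal_le_of_le_ofReal (sq_nonneg ε) hsum

/-- A function bounded by `C` which varies by at most `δ` on balls of radius `1` is within `δ` of
a `2 C`-Lipschitz function, namely its inf-convolution with `2 C d`. -/
theorem PseudoMetric.exists_lipschitz_approx {X : Type*} (d : PseudoMetric X ℝ) {f : X → ℝ}
    {C δ : ℝ} (hC0 : 0 ≤ C) (hδ : 0 ≤ δ) (hC : ∀ x, |f x| ≤ C)
    (hf : ∀ x y, d x y < 1 → |f x - f y| ≤ δ) :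
    ∃ F : X → ℝ, (∀ x, |f x - F x| ≤ δ) ∧ ∀ x y, F x - F y ≤ 2 * C * d x y := by
  have hd : ∀ x y, 0 ≤ d x y := fun x y => by
    have := d.triangle x y x
    rw [d.symm y x, d.refl] at this
    linarith
  have hbdd : ∀ x, BddBelow (Set.range fun y => f y + 2 * C * d x y) := fun x => by
    refine ⟨-C, ?_⟩
    rintro _ ⟨y, rfl⟩
    have := (abs_le.1 (hC y)).1
    have : 0 ≤ 2 * C * d x y := mul_nonneg (by linarith) (hd x y)
    dsimp only
    linarith
  refine ⟨fun x => ⨅ y, (f y + 2 * C * d x y), fun x => ?_, fun x y => ?_⟩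
  · have : Nonempty X := ⟨x⟩
    have h1 : (⨅ y, (f y + 2 * C * d x y)) ≤ f x := by
      simpa using ciInf_le (hbdd x) x
    have h2 : f x - δ ≤ ⨅ y, (f y + 2 * C * d x y) := by
      refine le_ciInf fun y => ?_
      rcases lt_or_ge (d x y) 1 with h | h
      · have := (abs_le.1 (hf x y h)).2
        have : 0 ≤ 2 * C * d x y := mul_nonneg (by linarith) (hd x y)
        linarith
      · -- At distance at least `1` the penalty `2 C d x y` exceeds the oscillation of `f`.
        have h3 := (abs_le.1 (hC y)).1
        have h4 := (abs_le.1 (hC x)).2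
        nlinarith
    exact abs_le.2 ⟨by linarith, by linarith⟩
  · have : Nonempty X := ⟨x⟩
    dsimp only
    rw [sub_le_iff_le_add']
    have : (⨅ z, (f z + 2 * C * d x z)) - 2 * C * d x y ≤ ⨅ z, (f z + 2 * C * d y z) := by
      refine le_ciInf fun z => ?_
      have h1 := ciInf_le (hbdd x) z
      have h2 := mul_le_mul_of_nonneg_left (d.triangle x y z) (by linarith : 0 ≤ 2 * C)
      linarith
    linarith

variable {G : Type*} [Group G] [TopologicalSpace G] [IsTopologicalGroup G]

/-- A subgroup of small amenable length that is `U`-dense at `E` yields a mean on the whole group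
that is almost invariant under `E` and almost multiplicative. -/
theorem MemT.exists_mean {U : Set G} {E : Finset G} {H : Subgroup G} {d : PseudoMetric H ℝ}
    (hT : MemT U E H d) {ε : ℝ} (hε : 0 ≤ ε) (h : amenableLength H d < ENNReal.ofReal ε) :
    ∃ μ : RUCB G →ₗ[ℝ] ℝ, IsRUCBMean μ ∧ ∀ (f : RUCB G) (C δ : ℝ), 0 ≤ C → 0 ≤ δ →
      (∀ x, |f.1 x| ≤ C) → (∀ u ∈ U, ∀ x, |f.1 (u * x) - f.1 x| ≤ δ) →
      (∀ g ∈ E, |μ (RUCB.leftTranslate g f) - μ f| ≤ δ) ∧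
        μ (f * f) ≤ μ f ^ 2 + 2 * ((2 * C) ^ 2 * ε ^ 2) + 2 * δ ^ 2 := by
  obtain ⟨ν, hν, hinv, hvar⟩ :=
    exists_mean_of_amenableLength_lt hT.memDelta.isRightInvariant hε h
  have hone : ν 1 = 1 := @IsMean.map_one _ (_) _ hν
  refine ⟨ν.comp (RUCB.restrict H).toLinearMap,
    @IsMean.mk G (_) _ hone
      fun f hf => @IsMean.nonneg _ (_) _ hν _ fun x => hf x,
    fun f C δ hC0 hδ hC hf => ⟨fun g hg => ?_, ?_⟩⟩
  · obtain ⟨u, hu, k, hk, rfl⟩ := Set.mem_mul.1 (hT.subset_mul hg)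
    change |ν (RUCB.restrict H (RUCB.leftTranslate (u * k) f)) - ν (RUCB.restrict H f)| ≤ δ
    rw [← hinv ⟨k, hk⟩ (RUCB.restrict H f)]
    refine IsMean.abs_sub_le hν fun x => ?_
    have := hf u hu (k * x)
    rwa [← mul_assoc] at this
  · obtain ⟨F, hF, hFL⟩ := d.exists_lipschitz_approx (f := fun x : H => f.1 x) hC0 hδ
      (fun x => hC x) fun x y hxy => by
        have h1 : d 1 (y * x⁻¹) = d x y := by
          have := hT.memDelta.isRightInvariant x 1 (y * x⁻¹)
          simpa using this.symm
        have h2 := hf _ (hT.ball_subset (y * x⁻¹) (by rwa [h1])) x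
        rw [abs_sub_comm]
        simpa using h2
    have hFb : ∀ x, |F x| ≤ C + δ := fun x => by
      have h1 := abs_le.1 (hF x)
      have h2 := abs_le.1 (hC x)
      exact abs_le.2 ⟨by linarith, by linarith⟩
    have h2C : 0 ≤ 2 * C := by linarith
    let F' : RUCB H := ⟨F, hT.memDelta.mem_RUCB h2C hFb hFL⟩
    exact IsMean.variance_le_of_abs_sub_le (f := RUCB.restrict H f) (g := F') hν
      (hvar F' (2 * C) h2C hFL) hF

end Concentration

/-! ### The limit along an ultrafilter -/

section Limit

variable {G : Type*} [Group G] [TopologicalSpace G] [IsTopologicalGroup G]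

/-- A limit of means that are asymptotically invariant and whose variances tend to zero is an
invariant point of the Samuel compactification. -/
theorem IsExtremelyAmenable.of_tendsto {ι : Type*} (l : Ultrafilter ι)
    {μ : ι → RUCB G →ₗ[ℝ] ℝ} (hμ : ∀ i, IsRUCBMean (μ i))
    (hinv : ∀ g f, Filter.Tendsto (fun i => μ i (RUCB.leftTranslate g f) - μ i f) l (𝓝 0))
    (hvar : ∀ f, Filter.Tendsto (fun i => μ i (f * f) - μ i f ^ 2) l (𝓝 0)) :
    IsExtremelyAmenable G := by
  have hlim : ∀ f : RUCB G, ∃ c, Filter.Tendsto (fun i => μ i f) l (𝓝 c) := fun f => by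
    obtain ⟨⟨C, hC⟩, -⟩ := mem_RUCB_iff.1 f.2
    obtain ⟨c, -, hc⟩ := (isCompact_Icc (a := -C) (b := C)).ultrafilter_le_nhds
      (l.map fun i => μ i f) (by
        rw [Filter.le_principal_iff]
        have hI : ∀ i, μ i f ∈ Set.Icc (-C) C := fun i =>
          abs_le.1 (IsMean.abs_le_const (hμ i) hC)
        exact Filter.mem_map.2 (Filter.univ_mem' hI))
    exact ⟨c, hc⟩
  choose ξ hξ using hlim
  have hadd : ∀ f g, ξ (f + g) = ξ f + ξ g := fun f g =>
    tendsto_nhds_unique (hξ (f + g)) (((hξ f).add (hξ g)).congr fun i => (map_add (μ i) f g).symm)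
  have hsmul : ∀ (c : ℝ) f, ξ (c • f) = c * ξ f := fun c f =>
    tendsto_nhds_unique (hξ (c • f))
      (((hξ f).const_mul c).congr fun i => (map_smul (μ i) c f).symm)
  have hone : ξ 1 = 1 := tendsto_nhds_unique (hξ 1) (tendsto_const_nhds.congr fun i =>
    (@IsMean.map_one _ (_) _ (hμ i)).symm)
  have hsq : ∀ f, ξ (f * f) = ξ f ^ 2 := fun f =>
    sub_eq_zero.1 (tendsto_nhds_unique ((hξ (f * f)).sub ((hξ f).pow 2)) (hvar f))
  -- Polarisation: compare the squares of `f + g`, `f` and `g`.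
  have hmul : ∀ f g, ξ (f * g) = ξ f * ξ g := fun f g => by
    have h1 := hsq (f + g)
    have h2 : (f + g) * (f + g) = f * f + (2 : ℝ) • (f * g) + g * g := by
      ext x
      simp
      ring
    rw [h2, hadd, hadd, hsmul, hadd, hsq, hsq] at h1
    linarith
  refine ⟨AlgHom.ofLinearMap { toFun := ξ, map_add' := hadd, map_smul' := hsmul } hone hmul,
    fun g f => ?_⟩
  exact sub_eq_zero.1 (tendsto_nhds_unique ((hξ (RUCB.leftTranslate g f)).sub (hξ f)) (hinv g f))

theorem isExtremelyAmenable_of_approximateAmenableLength_eq_zero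
    (h : approximateAmenableLength G = 0) : IsExtremelyAmenable G := by
  have hex : ∀ p : {U : Set G // U ∈ 𝓝 (1 : G)} × Finset G × ℕ, ∃ μ : RUCB G →ₗ[ℝ] ℝ,
      IsRUCBMean μ ∧ ∀ (f : RUCB G) (C δ : ℝ), 0 ≤ C → 0 ≤ δ →
      (∀ x, |f.1 x| ≤ C) → (∀ u ∈ p.1.1, ∀ x, |f.1 (u * x) - f.1 x| ≤ δ) →
      (∀ g ∈ p.2.1, |μ (RUCB.leftTranslate g f) - μ f| ≤ δ) ∧
        μ (f * f) ≤ μ f ^ 2 + 2 * ((2 * C) ^ 2 * (1 / ((p.2.2 : ℝ) + 1)) ^ 2) + 2 * δ ^ 2 := by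
    rintro ⟨⟨U, hU⟩, E, k⟩
    have hk : 0 < 1 / ((k : ℝ) + 1) := by positivity
    have h1 : (⨅ (H : Subgroup G) (d : PseudoMetric H ℝ) (_ : MemT U E H d),
        amenableLength H d) < ENNReal.ofReal (1 / ((k : ℝ) + 1)) := by
      refine lt_of_le_of_lt ?_ (ENNReal.ofReal_pos.2 hk)
      rw [← h]
      exact le_iSup_of_le U (le_iSup_of_le hU (le_iSup_of_le E le_rfl))
    obtain ⟨H, h1⟩ := iInf_lt_iff.1 h1
    obtain ⟨d, h1⟩ := iInf_lt_iff.1 h1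
    obtain ⟨hT, h1⟩ := iInf_lt_iff.1 h1
    exact hT.exists_mean hk.le h1
  choose μ hμ hμ' using hex
  have : Nonempty {U : Set G // U ∈ 𝓝 (1 : G)} := ⟨⟨Set.univ, Filter.univ_mem⟩⟩
  have : IsCodirectedOrder {U : Set G // U ∈ 𝓝 (1 : G)} := ⟨fun U V =>
    ⟨⟨U.1 ∩ V.1, Filter.inter_mem U.2 V.2⟩, Set.inter_subset_left, Set.inter_subset_right⟩⟩
  let l : Filter ({U : Set G // U ∈ 𝓝 (1 : G)} × Finset G × ℕ) :=
    Filter.atBot ×ˢ (Filter.atTop ×ˢ Filter.atTop)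
  -- For given `f` and `δ`, the estimates of `hμ'` apply along `l`.
  have key : ∀ (f : RUCB G) (C δ : ℝ), 0 < δ → (∀ x, |f.1 x| ≤ C) → ∀ᶠ p in l,
      (∀ g ∈ p.2.1, |μ p (RUCB.leftTranslate g f) - μ p f| ≤ δ) ∧ μ p (f * f) ≤
        μ p f ^ 2 + 2 * ((2 * C) ^ 2 * (1 / ((p.2.2 : ℝ) + 1)) ^ 2) + 2 * δ ^ 2 := by
    intro f C δ hδ hC
    obtain ⟨U, hU, hUf⟩ := (mem_RUCB_iff.1 f.2).2 δ hδ
    have hl : ∀ᶠ p in l, p.1 ≤ ⟨U, hU⟩ :=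
      Filter.tendsto_fst.eventually (Filter.eventually_le_atBot _)
    filter_upwards [hl] with p hp
    exact hμ' p f C δ ((abs_nonneg _).trans (hC 1)) hδ.le hC fun u hu => hUf u (hp hu)
  -- Any ultrafilter finer than `l` provides the limits.
  have hul : (Ultrafilter.of l : Filter _) ≤ l := Ultrafilter.of_le l
  refine IsExtremelyAmenable.of_tendsto (Ultrafilter.of l) hμ (fun g f => ?_) fun f => ?_
  · refine Filter.Tendsto.mono_left (Metric.tendsto_nhds.2 fun η hη => ?_) hul
    obtain ⟨⟨C, hC⟩, -⟩ := mem_RUCB_iff.1 f.2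
    have hg : ∀ᶠ p in l, {g} ≤ p.2.1 :=
      (Filter.tendsto_fst.comp Filter.tendsto_snd).eventually (Filter.eventually_ge_atTop _)
    filter_upwards [key f C (η / 2) (by positivity) hC, hg] with p hp hgp
    rw [Real.dist_eq, sub_zero]
    exact (hp.1 g (hgp (Finset.mem_singleton_self g))).trans_lt (by linarith)
  · refine Filter.Tendsto.mono_left (Metric.tendsto_nhds.2 fun η hη => ?_) hul
    obtain ⟨⟨C, hC⟩, -⟩ := mem_RUCB_iff.1 f.2
    have hk : Filter.Tendsto (fun k : ℕ => 2 * ((2 * C) ^ 2 * (1 / ((k : ℝ) + 1)) ^ 2))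
        Filter.atTop (𝓝 0) := by
      have := ((tendsto_one_div_add_atTop_nhds_zero_nat (𝕜 := ℝ)).pow 2).const_mul
        ((2 * C) ^ 2) |>.const_mul 2
      simpa using this
    have hk' : ∀ᶠ p in l, 2 * ((2 * C) ^ 2 * (1 / ((p.2.2 : ℝ) + 1)) ^ 2) < η / 2 :=
      (Filter.tendsto_snd.comp Filter.tendsto_snd).eventually
        (hk.eventually_lt_const (half_pos hη))
    filter_upwards [key f C (√(η / 4)) (by positivity) hC, hk'] with p hp hkp
    have h1 := hp.2
    rw [Real.sq_sqrt (by positivity)] at h1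
    rw [Real.dist_eq, sub_zero, abs_of_nonneg (sub_nonneg.2 (IsMean.sq_map_le (hμ p) f))]
    linarith

end Limit

/-! ### Rescaling and restricting pseudo-metrics -/

namespace PseudoMetric

/-- The pseudo-metric `c * d`. -/
def scale {X : Type*} (c : ℝ) (hc : 0 ≤ c) (d : PseudoMetric X ℝ) : PseudoMetric X ℝ where
  toFun x y := c * d x y
  refl' x := by simp
  symm' x y := by rw [d.symm]
  triangle' x y z := by
    rw [← mul_add]
    exact mul_le_mul_of_nonneg_left (d.triangle x y z) hc

theorem MemDelta.scale {G : Type*} [Group G] [TopologicalSpace G] {d : PseudoMetric G ℝ}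
    (hd : d.MemDelta) {c : ℝ} (hc : 0 < c) : (d.scale c hc.le).MemDelta where
  isBdd := by
    obtain ⟨C, hC⟩ := hd.isBdd
    exact ⟨c * C, fun x y => mul_le_mul_of_nonneg_left (hC x y) hc.le⟩
  isContinuous s hs := hd.isContinuous s fun x hx => by
    obtain ⟨r, hr, hrs⟩ := hs x hx
    refine ⟨r / c, by positivity, fun y hy => hrs ?_⟩
    have hy' : d x y < r / c := hy
    rw [lt_div_iff₀ hc, mul_comm] at hy'
    exact hy'
  isRightInvariant g x y := congrArg (c * ·) (hd.isRightInvariant g x y)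

theorem MemDelta.restrict {G : Type*} [Group G] [TopologicalSpace G] {d : PseudoMetric G ℝ}
    (hd : d.MemDelta) (H : Subgroup G) : (d.restrict H).MemDelta where
  isBdd := by
    obtain ⟨C, hC⟩ := hd.isBdd
    exact ⟨C, fun x y => hC x y⟩
  isContinuous s hs := isOpen_iff_mem_nhds.2 fun x hx => by
    obtain ⟨r, hr, hrs⟩ := hs x hx
    exact Filter.mem_of_superset (continuous_subtype_val.continuousAt.preimage_mem_nhds
      (ball_mem_nhds hd.isContinuous (x : G) hr)) hrs
  isRightInvariant g x y := hd.isRightInvariant g x y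

end PseudoMetric

theorem chainLength_scale {G : Type*} [Group G] {n : ℕ} (C : Fin (n + 1) → Subgroup G)
    (d : PseudoMetric G ℝ) {c : ℝ} (hc : 0 < c) :
    chainLength C (d.scale c hc.le) = ENNReal.ofReal c * chainLength C d := by
  have h0 : ENNReal.ofReal c ≠ 0 := (ENNReal.ofReal_pos.2 hc).ne'
  have h1 : ∀ i : Fin n,
      (⨆ g : G, ((d.scale c hc.le).translate g).cosetDiam (C i.succ) (C i.castSucc)) =
        ENNReal.ofReal c * ⨆ g : G, (d.translate g).cosetDiam (C i.succ) (C i.castSucc) := by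
    intro i
    simp only [PseudoMetric.cosetDiam, PseudoMetric.cosetDist, ENNReal.mul_iSup,
      ENNReal.mul_iInf_of_ne h0 ENNReal.ofReal_ne_top, ← ENNReal.ofReal_mul hc.le]
    rfl
  simp only [chainLength, h1, mul_pow, ← Finset.mul_sum]
  rw [ENNReal.mul_rpow_of_nonneg _ _ (by norm_num), ← ENNReal.rpow_natCast, ← ENNReal.rpow_mul]
  norm_num

section Scaling

variable {G : Type*} [Group G] [TopologicalSpace G] [IsTopologicalGroup G]

theorem amenableLength_scale (d : PseudoMetric G ℝ) {c : ℝ} (hc : 0 < c) :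
    amenableLength G (d.scale c hc.le) = ENNReal.ofReal c * amenableLength G d := by
  have h0 : ENNReal.ofReal c ≠ 0 := (ENNReal.ofReal_pos.2 hc).ne'
  simp only [amenableLength, ENNReal.mul_iInf_of_ne h0 ENNReal.ofReal_ne_top]
  exact iInf_congr fun n => iInf_congr fun C => iInf_congr fun _ => chainLength_scale C d hc

/-- Rescaling a compatible pseudo-metric makes its unit ball arbitrarily small, and multiplies
amenable lengths by a constant. -/
theorem approximateAmenableLength_eq_zero_of_isCompatible {d : PseudoMetric G ℝ}
    (hd : d.MemDelta) (hcomp : d.IsCompatible)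
    (h : ∀ U ∈ 𝓝 (1 : G), ∀ E : Finset G, (⨅ (H : Subgroup G) (_ : IsAmenable H)
      (_ : (E : Set G) ⊆ U * (H : Set G)), amenableLength H (d.restrict H)) = 0) :
    approximateAmenableLength G = 0 := by
  simp only [approximateAmenableLength, ENNReal.iSup_eq_zero]
  intro U hU E
  obtain ⟨V, hVU, hV, h1⟩ := mem_nhds_iff.1 hU
  obtain ⟨r, hr, hrV⟩ := (hcomp V).2 hV 1 h1
  have hc : 0 < r⁻¹ := by positivity
  refine le_antisymm ?_ zero_le
  rw [← mul_zero (ENNReal.ofReal r⁻¹), ← h U hU E]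
  simp only [ENNReal.mul_iInf_of_ne (ENNReal.ofReal_pos.2 hc).ne' ENNReal.ofReal_ne_top]
  refine le_iInf fun H => le_iInf fun hH => le_iInf fun hE => ?_
  rw [← amenableLength_scale _ hc]
  refine iInf_le_of_le H (iInf_le_of_le _ (iInf_le_of_le ?_ le_rfl))
  refine ⟨hH, (hd.restrict H).scale hc, hE, fun x hx => hVU (hrV ?_)⟩
  have hx' : r⁻¹ * d 1 x < 1 := hx
  rwa [inv_mul_lt_iff₀ hr, mul_one] at hx'

end Scaling

/-! ### Passing from a group to its improper subgroup -/

section Top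

variable {G : Type*} [Group G] [TopologicalSpace G] [IsTopologicalGroup G]

/-- Amenability passes to continuous homomorphic images, by pushing the mean forward. -/
theorem IsAmenable.of_surjective {H : Type*} [Group H] [TopologicalSpace H]
    [IsTopologicalGroup H] (hG : IsAmenable G) (φ : G →* H) (hφ : Continuous φ)
    (hsurj : Function.Surjective φ) : IsAmenable H := by
  obtain ⟨μ, hμ, hinv⟩ := hG
  have hmem : ∀ f : RUCB H, (fun x => f.1 (φ x)) ∈ RUCB G := fun f => by
    obtain ⟨⟨C, hC⟩, hf⟩ := mem_RUCB_iff.1 f.2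
    refine mem_RUCB_iff.2 ⟨⟨C, fun x => hC _⟩, fun ε hε => ?_⟩
    obtain ⟨U, hU, hUf⟩ := hf ε hε
    refine ⟨φ ⁻¹' U, hφ.continuousAt.preimage_mem_nhds (by simpa using hU), fun u hu x => ?_⟩
    rw [map_mul]
    exact hUf _ hu _
  let ν : RUCB H →ₗ[ℝ] ℝ :=
    { toFun := fun f => μ ⟨_, hmem f⟩
      map_add' := fun f g => map_add μ ⟨_, hmem f⟩ ⟨_, hmem g⟩
      map_smul' := fun c f => map_smul μ c ⟨_, hmem f⟩ }
  have hone : μ 1 = 1 := @IsMean.map_one _ (_) _ hμ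
  refine ⟨ν, @IsMean.mk H (_) ν hone
    fun f hf => @IsMean.nonneg _ (_) _ hμ _ fun x => hf (φ x), fun g f => ?_⟩
  obtain ⟨g, rfl⟩ := hsurj g
  refine Eq.trans (congrArg μ ?_) (hinv g ⟨_, hmem f⟩)
  ext x
  exact congrArg f.1 (map_mul φ g x).symm

theorem amenableLength_restrict_top_le (d : PseudoMetric G ℝ) :
    amenableLength (⊤ : Subgroup G) (d.restrict ⊤) ≤ amenableLength G d := by
  refine le_iInf fun n => le_iInf fun C => le_iInf fun hC => ?_
  let C' : Fin (n + 1) → Subgroup (⊤ : Subgroup G) := fun i => (C i).subgroupOf ⊤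
  have hC' : IsAmenableChain C' :=
    { amenable := fun i => (hC.amenable i).of_surjective
        { toFun := fun x => ⟨⟨x, trivial⟩, x.2⟩
          map_one' := rfl
          map_mul' := fun _ _ => rfl } (by
          exact (continuous_subtype_val.subtype_mk _).subtype_mk _)
        fun x => ⟨⟨x, x.2⟩, rfl⟩
      mono := fun i j hij x hx => hC.mono hij hx
      first := by simp [C', hC.first]
      last := by simp [C', hC.last] }
  refine iInf_le_of_le n (iInf_le_of_le C' (iInf_le_of_le hC' ?_))
  refine ENNReal.rpow_le_rpow (Finset.sum_le_sum fun i _ => pow_le_pow_left' ?_ 2) (by norm_num)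
  refine iSup_le fun g => le_iSup_of_le (g : G) ?_
  refine iSup_le fun x => iSup_le fun y => ?_
  refine le_iSup_of_le ⟨x, x.2⟩ (le_iSup_of_le ⟨y, y.2⟩ ?_)
  exact le_iInf fun h => iInf_le_of_le ⟨⟨h, trivial⟩, h.2⟩ le_rfl

/-- A chain ends in the whole group, which is therefore amenable if its amenable length is
finite. -/
theorem isAmenable_top_of_amenableLength_ne_top {d : PseudoMetric G ℝ}
    (h : amenableLength G d ≠ ∞) : IsAmenable (⊤ : Subgroup G) := by
  obtain ⟨n, h⟩ := iInf_lt_iff.1 (lt_top_iff_ne_top.2 h)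
  obtain ⟨C, h⟩ := iInf_lt_iff.1 h
  obtain ⟨hC, -⟩ := iInf_lt_iff.1 h
  rw [← hC.last]
  exact hC.amenable _

end Top

/-! ### Directed families of subgroups -/

section Directed

variable {G : Type*} [Group G] [TopologicalSpace G] [IsTopologicalGroup G]

/-- A member of a directed family with dense union is `U`-dense at a given finite set. -/
theorem exists_subset_mul_of_directedOn {𝓗 : Set (Subgroup G)} (hdir : DirectedOn (· ≤ ·) 𝓗)
    (hdense : closure (⋃ H ∈ 𝓗, (H : Set G)) = Set.univ) {U : Set G} (hU : U ∈ 𝓝 (1 : G))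
    (E : Finset G) : ∃ H ∈ 𝓗, (E : Set G) ⊆ U * (H : Set G) := by
  have hpt : ∀ g : G, ∃ H ∈ 𝓗, g ∈ U * (H : Set G) := fun g => by
    have hg : g ∈ closure (⋃ H ∈ 𝓗, (H : Set G)) := hdense ▸ trivial
    have hV : (fun y => g * y⁻¹) ⁻¹' U ∈ 𝓝 g := by
      have : Continuous fun y : G => g * y⁻¹ := by fun_prop
      exact this.continuousAt.preimage_mem_nhds (by simpa using hU)
    obtain ⟨h, hhU, hh⟩ := mem_closure_iff_nhds.1 hg _ hV
    obtain ⟨H, hH, hhH⟩ := Set.mem_iUnion₂.1 hh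
    exact ⟨H, hH, Set.mem_mul.2 ⟨_, hhU, h, hhH, by simp⟩⟩
  classical
  induction E using Finset.induction_on with
  | empty =>
    obtain ⟨H, hH, -⟩ := hpt 1
    exact ⟨H, hH, by simp⟩
  | insert g E _ ih =>
    obtain ⟨H₁, hH₁, h₁⟩ := ih
    obtain ⟨H₂, hH₂, h₂⟩ := hpt g
    obtain ⟨H, hH, hle₁, hle₂⟩ := hdir H₁ hH₁ H₂ hH₂
    refine ⟨H, hH, ?_⟩
    rw [Finset.coe_insert, Set.insert_subset_iff]
    exact ⟨Set.mul_subset_mul_left hle₂ h₂, h₁.trans (Set.mul_subset_mul_left hle₁)⟩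

end Directed

/-! ### Extreme amenability from vanishing amenable length -/

theorem mainTheorem2 {G : Type*} [Group G] [TopologicalSpace G] [IsTopologicalGroup G] :
    (approximateAmenableLength G = 0 → IsExtremelyAmenable G) ∧
    (∀ d : PseudoMetric G ℝ, d.IsBdd → d.IsCompatible → d.IsRightInvariant → d.IsMetric →
      ∀ 𝓗 : Set (Subgroup G), (∀ H ∈ 𝓗, IsAmenable H) → DirectedOn (· ≤ ·) 𝓗 →
        closure (⋃ H ∈ 𝓗, (H : Set G)) = Set.univ →
        Filter.liminf (fun H : 𝓗 => amenableLength H.1 (d.restrict H.1)) Filter.atTop = 0 →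
        approximateAmenableLength G = 0 ∧ IsExtremelyAmenable G) ∧
    (∀ d : PseudoMetric G ℝ, d.MemDelta → d.IsCompatible → amenableLength G d = 0 →
      approximateAmenableLength G = 0 ∧ IsExtremelyAmenable G) := by
  refine ⟨isExtremelyAmenable_of_approximateAmenableLength_eq_zero, ?_, ?_⟩
  · intro d hbdd hcomp hinv _ 𝓗 hamen hdir hdense hlim
    suffices h : approximateAmenableLength G = 0 from
      ⟨h, isExtremelyAmenable_of_approximateAmenableLength_eq_zero h⟩
    refine approximateAmenableLength_eq_zero_of_isCompatible
      ⟨hbdd, fun s => (hcomp s).1, hinv⟩ hcomp fun U hU E => ?_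
    obtain ⟨H₀, hH₀, hE⟩ := exists_subset_mul_of_directedOn hdir hdense hU E
    refine le_antisymm ?_ zero_le
    rw [← hlim]
    refine Filter.le_liminf_of_le (by isBoundedDefault) ?_
    filter_upwards [Filter.eventually_ge_atTop (⟨H₀, hH₀⟩ : 𝓗)] with H hH
    exact iInf_le_of_le H.1 (iInf_le_of_le (hamen H.1 H.2)
      (iInf_le_of_le (hE.trans (Set.mul_subset_mul_left hH)) le_rfl))
  · intro d hd hcomp hlen
    suffices h : approximateAmenableLength G = 0 from
      ⟨h, isExtremelyAmenable_of_approximateAmenableLength_eq_zero h⟩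
    refine approximateAmenableLength_eq_zero_of_isCompatible hd hcomp fun U hU E => ?_
    refine le_antisymm ?_ zero_le
    rw [← hlen]
    refine iInf_le_of_le ⊤ (iInf_le_of_le
      (isAmenable_top_of_amenableLength_ne_top (d := d) (by simp [hlen])) (iInf_le_of_le ?_
        (amenableLength_restrict_top_le d)))
    exact fun g _ => Set.mem_mul.2 ⟨1, mem_of_mem_nhds hU, g, trivial, one_mul g⟩
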